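/- **Setting.** Let $n,m,q_A,q_B,q_{Ad},q_{Bd},\eta,\kappa$ be nonnegative integers. Consider the nominal system with $\eta$ internal and $\kappa$ external point delays $$\dot x(t)=A(z^{A})x(t)+B(z^{B})u(t)+\sum_{j=1}^{\eta}A_j(z^{Ad})\,x(t-h_j)+\sum_{j=1}^{\kappa}B_j(z^{Bd})\,u(t-h'_j),$$ with state in $\mathbb C^n$, input in $\mathbb C^m$, and $$A(z^A)=A_0^{0}+\sum_{i=1}^{q_A}z^A_iA_i^{0},\quad B(z^B)=B_0^{0}+\sum_{i=1}^{q_B}z^B_iB_i^{0},\quad A_j(z^{Ad})=\sum_{i=1}^{q_{Ad}}z^{Ad}_iA_{ji},\quad B_j(z^{Bd})=\sum_{i=1}^{q_{Bd}}z^{Bd}_iB_{ji}$$ for constant complex matrices. Let $C=C^{A}\times C^{B}\times C^{Ad}\times C^{Bd}\subset\mathbb C^{q_A}\times\mathbb C^{q_B}\times\mathbb C^{q_{Ad}}\times\mathbb C^{q_{Bd}}$ be bounded, $z=(z^A,z^B,z^{Ad},z^{Bd})$. For $s\in\mathbb C$, $w\in\mathbb C^\eta$, $w'\in\mathbb C^\kappa$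 let $$Z(s,w,w',z)=\Bigl(sI_n-A(z^A)-\sum_j w_jA_j(z^{Ad})\ :\ B(z^B)+\sum_j w'_jB_j(z^{Bd})\Bigr),\qquad \hat Z=ZZ^*.$$ The system is *controllable on $C$ for the delays $h,h'$* (spectral controllability) if $\operatorname{rank}Z(s,(e^{-h_js})_j,(e^{-h'_js})_j,z)=n$ for all $s\in\mathbb C$, $z\in C$. It is *controllable on $C$ independent of the delays* if this holds for all $\eta$ pairwise distinct nonnegative $h_j$ and all $\kappa$ pairwise distinct nonnegative $h'_j$. Extended variables are tuples $\hat\sigma=(\sigma,\rho,\rho',\omega,\varphi,\varphi')$ with $\sigma,\omega\in\mathbb R$, $\rho_j,\rho'_j>0$, $\varphi_j,\varphi'_j\in[0,2\pi)$; put $s=\sigma+i\omega$ and $\hat Z(\hat\sigma,z)=\hat Z\bigl(s,(\rho_je^{i\varphi_j})_j,(\rho'_je^{i\varphi'_j})_j,z\bigr)$. Let $\Gamma_{\rm free}$ be the set of all of them. Let $\Gamma(h,h')$ be the set of those with $\rho_j=e^{-h_j\sigma}$, $\varphi_j\equiv-h_j\omega$, $\rho'_j=e^{-h'_j\sigma}$,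 $\varphi'_j\equiv-h'_j\omega\pmod{2\pi}$ for all $j$. Let $\Gamma_{\rm some}$ be the union of the $\Gamma(h,h')$ over all pairwise distinct nonnegative $h_j$ and pairwise distinct nonnegative $h'_j$. Denote by $\Gamma^R$ the part of a set $\Gamma$ with $|s|\le R$ and all $\rho_j,\rho'_j\le R$. **Finite cover test.** Let $f:\mathbb R^d\to\mathbb R$, $T\subset\mathbb R^d$ and $\delta>0$. *The test for $f$ on $T$ passes at level $\delta$* if $T$ is covered by finitely many open hyper-rectangles $H_i$, with sample points $p_i\in H_i\cap T$ and numbers $\varepsilon_i>0$, $M_i\ge0$, $\delta_i\ge\delta$, such that the edges of $H_i$ have length at most $\varepsilon_i$, all partial derivatives satisfy $|\partial_jf|\le M_i$ on $H_i$, $dM_i\varepsilon_i\le\delta_i$, and $f(p_i)-dM_i\varepsilon_i\ge\delta_i$. Complex variables are described by their real and imaginary parts. **Theorem.** (i) Let $\Gamma$ be $\Gamma_{\rm free}$ or $\Gamma_{\rm some}$. If there is $\delta>0$ with $\det\hat Z(\hat\sigma,z)\ge\delta$ for all $\hat\sigma\in\Gamma$, $z\in C$, then the system is controllable on $C$ independent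 of the delays. (ii) Let $h_1,\dots,h_\eta$ be positive and pairwise distinct, and $h'_1,\dots,h'_\kappa$ be positive and pairwise distinct. If there is $\delta>0$ with $\det\hat Z(\hat\sigma,z)\ge\delta$ for all $\hat\sigma\in\Gamma(h,h')$, $z\in C$, then the system is controllable on $C$ for the delays $h,h'$. (iii) These conditions can be tested by finitely many computations on finite covers: - For $\Gamma$ as in (i) and every $R>0$, the test for $\det\hat Z$ as a function of $(\hat\sigma,z)$ on $\Gamma^R\times C$ passes at some level $\delta>0$ if and only if $\det\hat Z$ has a positive lower bound on $\Gamma^R\times C$. There is $R_0>0$ such that, if the test passes at some level $\delta>0$ for one $R\ge R_0$, then the system is controllable on $C$ independent of the delays. - For $h,h'$ as in (ii) and every $R>0$, the test for $(s,z)\mapsto\det\hat Z(s,(e^{-h_js})_j,(e^{-h'_js})_j,z)$ on $\{|s|\le R\}\times C$ passes at some level $\delta>0$ if and only if $\det\hat Z$ has a positive lower bound on $\{\hat\sigma\in\Gamma(h,h'):|s|\le R\}\times C$. There is $R_0>0$ such that, if the test passes at some level $\delta>0$ for one $R\ge R_0$, then the system is controllable on $C$ for the delays $h,h'$. - For every $r$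 there is $R_0$ such that $\operatorname{rank}Z(s,w,w',z)=n$ whenever $|s|>R_0$, all $|w_j|\le r$, and $z\in C$ (with $w'$ arbitrary). -/

import Mathlib

open scoped Matrix

namespace DelayControl

/-- The nominal linear system with `η` internal (state) and `κ` external (input) point delays
`x'(t) = A(zA) x(t) + B(zB) u(t) + ∑ j, Aⱼ(zAd) x(t - hⱼ) + ∑ j, Bⱼ(zBd) u(t - h'ⱼ)`,
given by its constant coefficient matrices. The output equation plays no part in
controllability and is left out. The delays are not part of this data. -/
structure NominalSystem (n m qA qB qAd qBd η κ : ℕ) where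
  /-- coefficients of the dynamics matrix; index `0` is the constant term -/
  A : Fin (qA + 1) → Matrix (Fin n) (Fin n) ℂ
  /-- coefficients of the control matrix; index `0` is the constant term -/
  B : Fin (qB + 1) → Matrix (Fin n) (Fin m) ℂ
  /-- coefficients of the matrices multiplying the delayed states -/
  Ad : Fin η → Fin qAd → Matrix (Fin n) (Fin n) ℂ
  /-- coefficients of the matrices multiplying the delayed inputs -/
  Bd : Fin κ → Fin qBd → Matrix (Fin n) (Fin m) ℂ

/-- Parameter tuples `(zA, zB, zAd, zBd)`. The fixed leading entry `1` of `zA` and `zB` is not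
stored; it is put back by `Fin.cons 1` below. -/
abbrev Param (qA qB qAd qBd : ℕ) : Type :=
  (Fin qA → ℂ) × (Fin qB → ℂ) × (Fin qAd → ℂ) × (Fin qBd → ℂ)

/-- The tuple `(σ, ρ, ρ', ω, φ, φ')` of extended variables: `s = σ + i ω`, and `ρⱼ`, `φⱼ`
(resp. `ρ'ⱼ`, `φ'ⱼ`) are the modulus and the argument of the complex number that stands for
`exp (-hⱼ s)` (resp. for `exp (-h'ⱼ s)`). -/
structure SigmaHat (η κ : ℕ) where
  σ : ℝ
  ω : ℝ
  ρ : Fin η → ℝ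
  φ : Fin η → ℝ
  ρ' : Fin κ → ℝ
  φ' : Fin κ → ℝ

section Variables

variable {η κ : ℕ}

/-- The Laplace argument `s = σ + i ω`. -/
def SigmaHat.s (v : SigmaHat η κ) : ℂ := (v.σ : ℂ) + (v.ω : ℂ) * Complex.I

/-- The point of modulus `r` (for `0 ≤ r`) and argument `θ` of the complex plane. -/
noncomputable def polar (r θ : ℝ) : ℂ :=
  (r : ℂ) * ((Real.cos θ : ℂ) + (Real.sin θ : ℂ) * Complex.I)

/-- All values of the extended variables with no reference to delays: `s` is any complex number,
the moduli are positive and the angles lie in `[0, 2π)`. -/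
def delayFree (η κ : ℕ) : Set (SigmaHat η κ) :=
  {v | (∀ j, 0 < v.ρ j) ∧ (∀ j, v.φ j ∈ Set.Ico 0 (2 * Real.pi)) ∧
    (∀ j, 0 < v.ρ' j) ∧ (∀ j, v.φ' j ∈ Set.Ico 0 (2 * Real.pi))}

/-- The extended variables that satisfy the constraints given by the delays `h`, `h'`:
`ρⱼ = exp (-hⱼ σ)` (that is `σ = -ln ρⱼ / hⱼ` when `hⱼ ≠ 0`) and `φⱼ = -hⱼ ω` modulo `2π`,
and likewise for the external delays. So `polar ρⱼ φⱼ = exp (-hⱼ s)`. -/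
def linkedTo (h : Fin η → ℝ) (h' : Fin κ → ℝ) : Set (SigmaHat η κ) :=
  {v | v ∈ delayFree η κ ∧
    (∀ j, v.ρ j = Real.exp (-(h j * v.σ))) ∧
    (∀ j, ∃ k : ℤ, v.φ j = -(h j * v.ω) + 2 * Real.pi * k) ∧
    (∀ j, v.ρ' j = Real.exp (-(h' j * v.σ))) ∧
    (∀ j, ∃ k : ℤ, v.φ' j = -(h' j * v.ω) + 2 * Real.pi * k)}

/-- The extended variables that satisfy the constraints for some `η` distinct nonnegative internal
delays and some `κ` distinct nonnegative external delays. -/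
def linkedToSome (η κ : ℕ) : Set (SigmaHat η κ) :=
  {v | ∃ (h : Fin η → ℝ) (h' : Fin κ → ℝ), (∀ j, 0 ≤ h j) ∧ Function.Injective h ∧
    (∀ j, 0 ≤ h' j) ∧ Function.Injective h' ∧ v ∈ linkedTo h h'}

end Variables

section System

variable {n m qA qB qAd qBd η κ : ℕ}

/-- The spectral controllability matrix
`(s I - A(zA) - ∑ j, wⱼ Aⱼ(zAd) : B(zB) + ∑ j, w'ⱼ Bⱼ(zBd))` of the nominal system, where `wⱼ`,
`w'ⱼ` stand for `exp (-hⱼ s)`, `exp (-h'ⱼ s)`. -/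
noncomputable def NominalSystem.ZC (S : NominalSystem n m qA qB qAd qBd η κ)
    (s : ℂ) (w : Fin η → ℂ) (w' : Fin κ → ℂ) (z : Param qA qB qAd qBd) :
    Matrix (Fin n) (Fin n ⊕ Fin m) ℂ :=
  Matrix.fromCols
    (s • (1 : Matrix (Fin n) (Fin n) ℂ)
      - ∑ i, (Fin.cons 1 z.1 : Fin (qA + 1) → ℂ) i • S.A i
      - ∑ j, w j • ∑ i, z.2.2.1 i • S.Ad j i)
    (∑ i, (Fin.cons 1 z.2.1 : Fin (qB + 1) → ℂ) i • S.B i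
      + ∑ j, w' j • ∑ i, z.2.2.2 i • S.Bd j i)

/-- The determinant of `ZC * ZCᴴ`. It is a real number, see `det_im`; the real part only
changes its type. -/
noncomputable def NominalSystem.detZ (S : NominalSystem n m qA qB qAd qBd η κ)
    (s : ℂ) (w : Fin η → ℂ) (w' : Fin κ → ℂ) (z : Param qA qB qAd qBd) : ℝ :=
  (S.ZC s w w' z * (S.ZC s w w' z)ᴴ).det.re

theorem NominalSystem.det_im (S : NominalSystem n m qA qB qAd qBd η κ)
    (s : ℂ) (w : Fin η → ℂ) (w' : Fin κ → ℂ) (z : Param qA qB qAd qBd) :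
    (S.ZC s w w' z * (S.ZC s w w' z)ᴴ).det.im = 0 := by
  rw [← Complex.conj_eq_iff_im]
  have h := (Matrix.isHermitian_mul_conjTranspose_self (S.ZC s w w' z)).eq
  have h2 := Matrix.det_conjTranspose (S.ZC s w w' z * (S.ZC s w w' z)ᴴ)
  rw [h] at h2
  exact h2.symm

/-- `detZ` at a value of the extended variables. -/
noncomputable def NominalSystem.detHat (S : NominalSystem n m qA qB qAd qBd η κ)
    (v : SigmaHat η κ) (z : Param qA qB qAd qBd) : ℝ :=
  S.detZ v.s (fun j => polar (v.ρ j) (v.φ j)) (fun j => polar (v.ρ' j) (v.φ' j)) z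

/-- (Spectral) controllability on the parameter set `C` for the delays `h`, `h'`: the spectral
controllability matrix has full rank at every complex `s`. -/
def NominalSystem.Controllable (S : NominalSystem n m qA qB qAd qBd η κ)
    (h : Fin η → ℝ) (h' : Fin κ → ℝ) (C : Set (Param qA qB qAd qBd)) : Prop :=
  ∀ s : ℂ, ∀ z ∈ C,
    (S.ZC s (fun j => Complex.exp (-(h j * s))) (fun j => Complex.exp (-(h' j * s))) z).rank = n

/-- Controllability on `C` independent of the delays. -/
def NominalSystem.ControllableIndep (S : NominalSystem n m qA qB qAd qBd η κ)
    (C : Set (Param qA qB qAd qBd)) : Prop :=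
  ∀ (h : Fin η → ℝ) (h' : Fin κ → ℝ), (∀ j, 0 ≤ h j) → Function.Injective h →
    (∀ j, 0 ≤ h' j) → Function.Injective h' → S.Controllable h h' C

/-- The determinant is at least `δ` for all extended variables in `Γ` and all parameters
in `C`. -/
def NominalSystem.LowerBound (S : NominalSystem n m qA qB qAd qBd η κ)
    (Γ : Set (SigmaHat η κ)) (C : Set (Param qA qB qAd qBd)) (δ : ℝ) : Prop :=
  ∀ v ∈ Γ, ∀ z ∈ C, δ ≤ S.detHat v z

end System

section Covers

/-- The open hyper-rectangle with lower corner `a` and upper corner `b`. -/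
def box {ι : Type} (a b : ι → ℝ) : Set (ι → ℝ) :=
  {x | ∀ j, x j ∈ Set.Ioo (a j) (b j)}

/-- The `j`-th partial derivative. -/
noncomputable def partialDeriv {ι : Type} [DecidableEq ι] (f : (ι → ℝ) → ℝ) (j : ι)
    (x : ι → ℝ) : ℝ :=
  deriv (fun t => f (Function.update x j t)) (x j)

/-- A finite cover of `T` by open hyper-rectangles, with one sample point `p i ∈ T` in each,
passes the test for `f` at level `δ`: on the `i`-th hyper-rectangle, whose edges have length at
most `ε i`, all partial derivatives are bounded by `M i`, and
`ε i ≤ δ' i / (d * M i)`, `f (p i) - d * M i * ε i ≥ δ' i ≥ δ`, where `d` is the number of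
coordinates. The function is evaluated at finitely many points only. -/
def FiniteCoverTest {ι : Type} [Fintype ι] [DecidableEq ι] (f : (ι → ℝ) → ℝ)
    (T : Set (ι → ℝ)) (δ : ℝ) : Prop :=
  ∃ (N : ℕ) (a b p : Fin N → ι → ℝ) (ε M δ' : Fin N → ℝ),
    T ⊆ ⋃ i, box (a i) (b i) ∧
    ∀ i, p i ∈ T ∧ p i ∈ box (a i) (b i) ∧
      0 < ε i ∧ (∀ j, b i j - a i j ≤ ε i) ∧
      0 ≤ M i ∧ (∀ x ∈ box (a i) (b i), ∀ j, |partialDeriv f j x| ≤ M i) ∧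
      δ ≤ δ' i ∧
      Fintype.card ι * M i * ε i ≤ δ' i ∧
      δ' i ≤ f (p i) - Fintype.card ι * M i * ε i

/-- Names of the real coordinates of `(s, z)`: the real and imaginary parts of `s` and of the
entries of the parameters. -/
inductive Coord (qA qB qAd qBd : ℕ) : Type
  | sigma : Coord qA qB qAd qBd
  | omega : Coord qA qB qAd qBd
  | reA (i : Fin qA) : Coord qA qB qAd qBd
  | imA (i : Fin qA) : Coord qA qB qAd qBd
  | reB (i : Fin qB) : Coord qA qB qAd qBd
  | imB (i : Fin qB) : Coord qA qB qAd qBd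
  | reAd (i : Fin qAd) : Coord qA qB qAd qBd
  | imAd (i : Fin qAd) : Coord qA qB qAd qBd
  | reBd (i : Fin qBd) : Coord qA qB qAd qBd
  | imBd (i : Fin qBd) : Coord qA qB qAd qBd
  deriving DecidableEq, Fintype

/-- Names of the additional real coordinates `ρ`, `φ`, `ρ'`, `φ'`. -/
inductive DelayCoord (η κ : ℕ) : Type
  | rho (j : Fin η) : DelayCoord η κ
  | phi (j : Fin η) : DelayCoord η κ
  | rho' (j : Fin κ) : DelayCoord η κ
  | phi' (j : Fin κ) : DelayCoord η κ
  deriving DecidableEq, Fintype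

variable {n m qA qB qAd qBd η κ : ℕ}

/-- The Laplace argument with the given real coordinates. -/
def argOf (x : Coord qA qB qAd qBd → ℝ) : ℂ :=
  ⟨x Coord.sigma, x Coord.omega⟩

/-- The parameter tuple with the given real coordinates. -/
def paramOf (x : Coord qA qB qAd qBd → ℝ) : Param qA qB qAd qBd :=
  (fun i => ⟨x (Coord.reA i), x (Coord.imA i)⟩, fun i => ⟨x (Coord.reB i), x (Coord.imB i)⟩,
    fun i => ⟨x (Coord.reAd i), x (Coord.imAd i)⟩, fun i => ⟨x (Coord.reBd i), x (Coord.imBd i)⟩)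

/-- The extended variables with the given real coordinates. -/
def extOf (x : Coord qA qB qAd qBd ⊕ DelayCoord η κ → ℝ) : SigmaHat η κ where
  σ := x (Sum.inl Coord.sigma)
  ω := x (Sum.inl Coord.omega)
  ρ := fun j => x (Sum.inr (DelayCoord.rho j))
  φ := fun j => x (Sum.inr (DelayCoord.phi j))
  ρ' := fun j => x (Sum.inr (DelayCoord.rho' j))
  φ' := fun j => x (Sum.inr (DelayCoord.phi' j))

/-- The determinant for the delays `h`, `h'` as a function of the real coordinates of `(s, z)`. -/
noncomputable def NominalSystem.detDelay (S : NominalSystem n m qA qB qAd qBd η κ)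
    (h : Fin η → ℝ) (h' : Fin κ → ℝ) (x : Coord qA qB qAd qBd → ℝ) : ℝ :=
  S.detZ (argOf x) (fun j => Complex.exp (-(h j * argOf x)))
    (fun j => Complex.exp (-(h' j * argOf x))) (paramOf x)

/-- The determinant as a function of all real coordinates of the extended variables and the
parameters. -/
noncomputable def NominalSystem.detExt (S : NominalSystem n m qA qB qAd qBd η κ)
    (x : Coord qA qB qAd qBd ⊕ DelayCoord η κ → ℝ) : ℝ :=
  S.detHat (extOf x) (paramOf fun c => x (Sum.inl c))

/-- The part of a set of extended variables where `s` and all moduli have size at most `R`. -/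
def truncate (Γ : Set (SigmaHat η κ)) (R : ℝ) : Set (SigmaHat η κ) :=
  {v | v ∈ Γ ∧ ‖v.s‖ ≤ R ∧ (∀ j, v.ρ j ≤ R) ∧ (∀ j, v.ρ' j ≤ R)}

/-- The product of the closed disc `‖s‖ ≤ R` and the parameter set `C`, in real coordinates. -/
def regionDelay (C : Set (Param qA qB qAd qBd)) (R : ℝ) : Set (Coord qA qB qAd qBd → ℝ) :=
  {x | ‖argOf x‖ ≤ R ∧ paramOf x ∈ C}

/-- The product of a truncated set of extended variables and the parameter set `C`, in real
coordinates. -/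
def regionExt (Γ : Set (SigmaHat η κ)) (C : Set (Param qA qB qAd qBd)) (R : ℝ) :
    Set (Coord qA qB qAd qBd ⊕ DelayCoord η κ → ℝ) :=
  {x | extOf x ∈ truncate Γ R ∧ paramOf (fun c => x (Sum.inl c)) ∈ C}

end Covers

end DelayControl

namespace DelayControl

/-! ### The finite cover test for a `C¹` function on a bounded set. -/

section CoverTest

/-! A nonzero determinant of `Z Zᴴ` makes this product invertible, so `Z` has full row rank. Every
`s` lifts to extended variables linked to given delays: the moduli are forced and the angles are
reduced modulo `2π`. At such a point the extended determinant is the one of the delay system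
(`exists_mem_linkedTo`, `detHat_of_mem_linkedTo`). Hence a positive lower bound on any `Γ`
containing the linked points gives controllability.

The cover test is the mean value inequality: on a convex box with edges at most `ε` and partial
derivatives at most `M`, a function varies by at most `d M ε`, so one sample controls the whole box
(`FiniteCoverTest.le_apply`). Conversely, a `C¹` function has bounded derivative near a bounded set,
and a fine enough finite net turns a positive lower bound into a passing test
(`exists_finiteCoverTest`). The determinants are `C¹` in the real coordinates, and the truncated
regions are bounded.

The radius `R₀` of the truncated tests is not computed: if controllability fails, it fails at a
single point, which every large truncation contains. For large `|s|` and bounded `w`, the left block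
`sI - F` is invertible because `F` is bounded. -/

theorem convex_box {ι : Type} (a b : ι → ℝ) : Convex ℝ (box a b) := by
  have : box a b = Set.univ.pi fun j => Set.Ioo (a j) (b j) := by
    ext x
    simp [box]
  rw [this]
  exact convex_pi fun j _ => convex_Ioo _ _

/-- In the sup norm a cube is a ball, so a metric net is a cover by hyper-rectangles. With no
coordinates and `r ≤ 0` this fails: the box is everything and the ball is empty. -/
theorem box_sub_add_eq_ball {ι : Type} [Fintype ι] [Nonempty ι] (p : ι → ℝ) (r : ℝ) :
    box (fun j => p j - r) (fun j => p j + r) = Metric.ball p r := by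
  rw [ball_pi']
  ext x
  simp [box, Real.ball_eq_Ioo]

variable {ι : Type} [Fintype ι] [DecidableEq ι]

theorem partialDeriv_eq_fderiv {f : (ι → ℝ) → ℝ} (hf : Differentiable ℝ f) (j : ι) (x : ι → ℝ) :
    partialDeriv f j x = fderiv ℝ f x (Pi.single j 1) := by
  have h1 : HasDerivAt (Function.update x j) (Pi.single j (1 : ℝ)) (x j) :=
    hasDerivAt_update x j (x j)
  have h2 : HasFDerivAt f (fderiv ℝ f x) (Function.update x j (x j)) := by
    rw [Function.update_eq_self]
    exact (hf x).hasFDerivAt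
  exact (h2.comp_hasDerivAt (x j) h1).deriv

/-- The dual of the sup norm is the `ℓ¹` norm, so the `d` partial derivatives add up; this is the
origin of the factor `d` in the test. -/
theorem norm_fderiv_le_of_partialDeriv_le {f : (ι → ℝ) → ℝ} (hf : Differentiable ℝ f)
    {x : ι → ℝ} {M : ℝ} (hM : 0 ≤ M) (h : ∀ j, |partialDeriv f j x| ≤ M) :
    ‖fderiv ℝ f x‖ ≤ Fintype.card ι * M := by
  refine ContinuousLinearMap.opNorm_le_bound _ (by positivity) fun v => ?_
  have hv : fderiv ℝ f x v = ∑ j, v j * partialDeriv f j x := by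
    conv_lhs => rw [pi_eq_sum_univ' v]
    simp only [map_sum, map_smul, smul_eq_mul]
    refine Finset.sum_congr rfl fun j _ => ?_
    rw [partialDeriv_eq_fderiv hf]
  rw [hv]
  calc ‖∑ j, v j * partialDeriv f j x‖ ≤ ∑ j : ι, ‖v‖ * M := by
        refine norm_sum_le_of_le _ fun j _ => ?_
        rw [norm_mul]
        exact mul_le_mul (norm_le_pi_norm v j) (h j) (norm_nonneg _) (norm_nonneg _)
    _ = Fintype.card ι * M * ‖v‖ := by
        simp [Finset.sum_const]
        ring

theorem abs_sub_le_of_mem_box {f : (ι → ℝ) → ℝ} (hf : Differentiable ℝ f) {a b x p : ι → ℝ}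
    {ε M : ℝ} (hε : 0 ≤ ε) (hab : ∀ j, b j - a j ≤ ε) (hM : 0 ≤ M)
    (h : ∀ y ∈ box a b, ∀ j, |partialDeriv f j y| ≤ M) (hx : x ∈ box a b) (hp : p ∈ box a b) :
    |f x - f p| ≤ Fintype.card ι * M * ε := by
  have h1 := (convex_box a b).norm_image_sub_le_of_norm_fderiv_le (𝕜 := ℝ)
    (fun y _ => hf y) (fun y hy => norm_fderiv_le_of_partialDeriv_le hf hM (h y hy)) hp hx
  refine h1.trans (mul_le_mul_of_nonneg_left ?_ (by positivity))
  refine (pi_norm_le_iff_of_nonneg hε).2 fun j => ?_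
  have hxj := hx j
  have hpj := hp j
  have hj := hab j
  rw [Pi.sub_apply, Real.norm_eq_abs, abs_le]
  constructor <;> linarith [hxj.1, hxj.2, hpj.1, hpj.2]

theorem FiniteCoverTest.le_apply {f : (ι → ℝ) → ℝ} (hf : Differentiable ℝ f)
    {T : Set (ι → ℝ)} {δ : ℝ} (h : FiniteCoverTest f T δ) {x : ι → ℝ} (hx : x ∈ T) :
    δ ≤ f x := by
  obtain ⟨N, a, b, p, ε, M, δ', hT, h⟩ := h
  obtain ⟨i, hi⟩ := Set.mem_iUnion.1 (hT hx)
  obtain ⟨-, hp, hε, hab, hM, hd, h1, -, h3⟩ := h i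
  have := (abs_le.1 (abs_sub_le_of_mem_box hf hε.le hab hM hd hi hp)).1
  linarith

/-- All boxes are cubes of one size centred at the points of a finite net. Half of `δ` pays for the
variation on a cube, and the other half remains as the level. -/
theorem exists_finiteCoverTest [Nonempty ι] {f : (ι → ℝ) → ℝ} (hf : ContDiff ℝ 1 f)
    {T : Set (ι → ℝ)} (hT : Bornology.IsBounded T) {δ : ℝ} (hδ : 0 < δ)
    (h : ∀ x ∈ T, δ ≤ f x) : FiniteCoverTest f T (δ / 2) := by
  have hdiff : Differentiable ℝ f := hf.differentiable one_ne_zero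
  -- The boxes may leave `T`, and `T` need not be closed; the closed thickening is compact and
  -- contains every box with `ε ≤ 1`.
  have hK : IsCompact (Metric.cthickening 1 T) :=
    Metric.isCompact_of_isClosed_isBounded Metric.isClosed_cthickening hT.cthickening
  obtain ⟨M₀, hM₀⟩ := hK.exists_bound_of_continuousOn
    (hf.continuous_fderiv one_ne_zero).continuousOn
  -- The maximum with `1` keeps `M` positive, so that the definition of `ε` may divide by it.
  set M : ℝ := max M₀ 1
  have hM : 0 < M := lt_max_of_lt_right one_pos
  have hcard : 0 < (Fintype.card ι : ℝ) := by exact_mod_cast Fintype.card_pos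
  set ε : ℝ := min 1 (δ / 2 / (Fintype.card ι * M))
  have hε : 0 < ε := lt_min one_pos (by positivity)
  have hεM : Fintype.card ι * M * ε ≤ δ / 2 := by
    calc Fintype.card ι * M * ε ≤ Fintype.card ι * M * (δ / 2 / (Fintype.card ι * M)) :=
          mul_le_mul_of_nonneg_left (min_le_right _ _) (by positivity)
      _ = δ / 2 := by field_simp
  -- The net is chosen inside `T`, since sample points must belong to `T`; radius `ε / 2` gives
  -- edges of length `ε`.
  obtain ⟨t, htT, htf, hcov⟩ := Metric.finite_approx_of_totallyBounded
    (hK.totallyBounded.subset (Metric.self_subset_cthickening T)) (ε / 2) (half_pos hε)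
  have := htf.fintype
  let e := Fintype.equivFin t
  refine ⟨Fintype.card t, fun i j => (e.symm i : ι → ℝ) j - ε / 2,
    fun i j => (e.symm i : ι → ℝ) j + ε / 2, fun i => e.symm i, fun _ => ε, fun _ => M,
    fun _ => δ / 2, fun x hx => ?_, fun i => ?_⟩
  · obtain ⟨y, hy, hxy⟩ := Set.mem_iUnion₂.1 (hcov hx)
    refine Set.mem_iUnion.2 ⟨e ⟨y, hy⟩, ?_⟩
    rw [box_sub_add_eq_ball]
    simpa using hxy
  · have hp : (e.symm i : ι → ℝ) ∈ T := htT (e.symm i).2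
    refine ⟨hp, ?_, hε, fun j => by ring_nf; exact le_rfl, hM.le, fun x hx j => ?_, le_rfl, hεM, ?_⟩
    · rw [box_sub_add_eq_ball]
      exact Metric.mem_ball_self (half_pos hε)
    · rw [box_sub_add_eq_ball] at hx
      have hxK : x ∈ Metric.cthickening 1 T := by
        refine Metric.mem_cthickening_of_dist_le x _ 1 T hp ?_
        have := Metric.mem_ball.1 hx
        have : ε ≤ 1 := min_le_left _ _
        linarith
      rw [partialDeriv_eq_fderiv hdiff, ← Real.norm_eq_abs]
      refine (ContinuousLinearMap.le_opNorm _ _).trans ?_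
      rw [Pi.norm_single, norm_one, mul_one]
      exact (hM₀ x hxK).trans (le_max_left _ _)
    · linarith [h _ hp]

theorem exists_finiteCoverTest_iff [Nonempty ι] {f : (ι → ℝ) → ℝ} (hf : ContDiff ℝ 1 f)
    {T : Set (ι → ℝ)} (hT : Bornology.IsBounded T) :
    (∃ δ, 0 < δ ∧ FiniteCoverTest f T δ) ↔ ∃ δ, 0 < δ ∧ ∀ x ∈ T, δ ≤ f x :=
  ⟨fun ⟨δ, hδ, h⟩ => ⟨δ, hδ, fun _ hx => h.le_apply (hf.differentiable one_ne_zero) hx⟩,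
    fun ⟨δ, hδ, h⟩ => ⟨δ / 2, half_pos hδ, exists_finiteCoverTest hf hT hδ h⟩⟩

end CoverTest

/-! ### Extended variables and the delay exponentials. -/

section Variables

variable {η κ : ℕ}

theorem polar_eq_exp (r θ : ℝ) : polar r θ = r * Complex.exp (θ * Complex.I) := by
  rw [polar, Complex.exp_mul_I, Complex.ofReal_cos, Complex.ofReal_sin]

theorem polar_eq_exp_of_linked {h σ ω r θ : ℝ} (hr : r = Real.exp (-(h * σ)))
    (hθ : ∃ k : ℤ, θ = -(h * ω) + 2 * Real.pi * k) :
    polar r θ = Complex.exp (-(h * (σ + ω * Complex.I))) := by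
  obtain ⟨k, rfl⟩ := hθ
  rw [polar_eq_exp, hr, Complex.ofReal_exp, ← Complex.exp_add, Complex.exp_eq_exp_iff_exists_int]
  refine ⟨k, ?_⟩
  push_cast
  ring

theorem exists_mem_linkedTo (h : Fin η → ℝ) (h' : Fin κ → ℝ) (s : ℂ) :
    ∃ v ∈ linkedTo h h', v.s = s := by
  have key : ∀ t : ℝ, toIcoMod Real.two_pi_pos 0 t ∈ Set.Ico 0 (2 * Real.pi) ∧
      ∃ k : ℤ, toIcoMod Real.two_pi_pos 0 t = t + 2 * Real.pi * k := by
    intro t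
    refine ⟨by simpa using toIcoMod_mem_Ico Real.two_pi_pos 0 t,
      -- `toIcoMod` subtracts `toIcoDiv` periods, hence the sign.
      -toIcoDiv Real.two_pi_pos 0 t, ?_⟩
    rw [toIcoMod, zsmul_eq_mul]
    push_cast
    ring
  refine ⟨⟨s.re, s.im, fun j => Real.exp (-(h j * s.re)),
    fun j => toIcoMod Real.two_pi_pos 0 (-(h j * s.im)), fun j => Real.exp (-(h' j * s.re)),
    fun j => toIcoMod Real.two_pi_pos 0 (-(h' j * s.im))⟩, ⟨⟨fun j => Real.exp_pos _,
    fun j => (key _).1, fun j => Real.exp_pos _, fun j => (key _).1⟩, fun j => rfl,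
    fun j => (key _).2, fun j => rfl, fun j => (key _).2⟩, Complex.re_add_im s⟩

end Variables

/-! ### Determinant bounds, rank and controllability. -/

section System

variable {n m qA qB qAd qBd η κ : ℕ}

theorem NominalSystem.detHat_of_mem_linkedTo (S : NominalSystem n m qA qB qAd qBd η κ)
    {h : Fin η → ℝ} {h' : Fin κ → ℝ} {v : SigmaHat η κ} (hv : v ∈ linkedTo h h')
    (z : Param qA qB qAd qBd) :
    S.detHat v z = S.detZ v.s (fun j => Complex.exp (-(h j * v.s)))
      (fun j => Complex.exp (-(h' j * v.s))) z := by
  obtain ⟨-, h1, h2, h3, h4⟩ := hv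
  rw [NominalSystem.detHat]
  congr 1
  · exact funext fun j => polar_eq_exp_of_linked (h1 j) (h2 j)
  · exact funext fun j => polar_eq_exp_of_linked (h3 j) (h4 j)

theorem NominalSystem.rank_eq_of_detZ_pos (S : NominalSystem n m qA qB qAd qBd η κ)
    {s : ℂ} {w : Fin η → ℂ} {w' : Fin κ → ℂ} {z : Param qA qB qAd qBd}
    (h : 0 < S.detZ s w w' z) : (S.ZC s w w' z).rank = n := by
  have hdet : (S.ZC s w w' z * (S.ZC s w w' z)ᴴ).det ≠ 0 := fun h0 => by
    rw [NominalSystem.detZ, h0] at h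
    exact lt_irrefl _ h
  have h1 := Matrix.rank_of_isUnit _ ((Matrix.isUnit_iff_isUnit_det _).2 hdet.isUnit)
  rw [Fintype.card_fin] at h1
  exact le_antisymm ((Matrix.rank_le_card_height _).trans_eq (Fintype.card_fin n))
    (h1.symm.le.trans (Matrix.rank_mul_le_left _ _))

theorem NominalSystem.controllable_of_lowerBound (S : NominalSystem n m qA qB qAd qBd η κ)
    {h : Fin η → ℝ} {h' : Fin κ → ℝ} {C : Set (Param qA qB qAd qBd)} {δ : ℝ} (hδ : 0 < δ)
    (H : S.LowerBound (linkedTo h h') C δ) : S.Controllable h h' C := by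
  intro s z hz
  obtain ⟨v, hv, rfl⟩ := exists_mem_linkedTo h h' s
  refine S.rank_eq_of_detZ_pos (hδ.trans_le ?_)
  rw [← S.detHat_of_mem_linkedTo hv]
  exact H v hv z hz

theorem linkedTo_subset_linkedToSome {h : Fin η → ℝ} {h' : Fin κ → ℝ} (h0 : ∀ j, 0 ≤ h j)
    (hi : Function.Injective h) (h0' : ∀ j, 0 ≤ h' j) (hi' : Function.Injective h') :
    linkedTo h h' ⊆ linkedToSome η κ :=
  fun _ hv => ⟨h, h', h0, hi, h0', hi', hv⟩

theorem linkedToSome_subset_delayFree : linkedToSome η κ ⊆ delayFree η κ :=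
  fun _ ⟨_, _, _, _, _, _, hv⟩ => hv.1

theorem NominalSystem.controllableIndep_of_lowerBound
    (S : NominalSystem n m qA qB qAd qBd η κ) {Γ : Set (SigmaHat η κ)}
    (hΓ : linkedToSome η κ ⊆ Γ) {C : Set (Param qA qB qAd qBd)} {δ : ℝ} (hδ : 0 < δ)
    (H : S.LowerBound Γ C δ) : S.ControllableIndep C :=
  fun _ _ h0 hi h0' hi' => S.controllable_of_lowerBound hδ fun v hv z hz =>
    H v (hΓ (linkedTo_subset_linkedToSome h0 hi h0' hi' hv)) z hz

/-- Failure of controllability is visible at a single value of the extended variables. -/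
theorem NominalSystem.exists_detHat_nonpos (S : NominalSystem n m qA qB qAd qBd η κ)
    {h : Fin η → ℝ} {h' : Fin κ → ℝ} {C : Set (Param qA qB qAd qBd)}
    (H : ¬ S.Controllable h h' C) :
    ∃ v ∈ linkedTo h h', ∃ z ∈ C, S.detHat v z ≤ 0 := by
  by_contra! hpos
  refine H fun s z hz => ?_
  obtain ⟨v, hv, rfl⟩ := exists_mem_linkedTo h h' s
  refine S.rank_eq_of_detZ_pos ?_
  rw [← S.detHat_of_mem_linkedTo hv]
  exact hpos v hv z hz

theorem exists_mem_truncate (v : SigmaHat η κ) :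
    ∃ R₀ : ℝ, 0 < R₀ ∧ ∀ R, R₀ ≤ R → ∀ Γ : Set (SigmaHat η κ), v ∈ Γ → v ∈ truncate Γ R := by
  refine ⟨1 + ‖v.s‖ + ‖v.ρ‖ + ‖v.ρ'‖, by positivity, fun R hR Γ hv => ⟨hv, ?_, fun j => ?_,
    fun j => ?_⟩⟩
  · linarith [norm_nonneg v.ρ, norm_nonneg v.ρ']
  · linarith [norm_nonneg v.s, norm_nonneg v.ρ', le_abs_self (v.ρ j), norm_le_pi_norm v.ρ j,
      Real.norm_eq_abs (v.ρ j)]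
  · linarith [norm_nonneg v.s, norm_nonneg v.ρ, le_abs_self (v.ρ' j), norm_le_pi_norm v.ρ' j,
      Real.norm_eq_abs (v.ρ' j)]

/-- The proof splits on the conclusion: if it holds, any radius serves; if not, `R₀` is taken large
enough for the truncation to contain one point with nonpositive determinant, which contradicts any
positive lower bound. -/
theorem NominalSystem.exists_radius_controllableIndep
    (S : NominalSystem n m qA qB qAd qBd η κ) {Γ : Set (SigmaHat η κ)}
    (hΓ : linkedToSome η κ ⊆ Γ) (C : Set (Param qA qB qAd qBd)) :
    ∃ R₀ : ℝ, 0 < R₀ ∧ ∀ R, R₀ ≤ R → ∀ δ, 0 < δ → S.LowerBound (truncate Γ R) C δ →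
      S.ControllableIndep C := by
  by_cases H : S.ControllableIndep C
  · exact ⟨1, one_pos, fun _ _ _ _ _ => H⟩
  · unfold NominalSystem.ControllableIndep at H
    push Not at H
    obtain ⟨h, h', h0, hi, h0', hi', H⟩ := H
    obtain ⟨v, hv, z, hz, hle⟩ := S.exists_detHat_nonpos H
    obtain ⟨R₀, hR₀, hmem⟩ := exists_mem_truncate v
    refine ⟨R₀, hR₀, fun R hR δ hδ hlow => absurd (hlow v (hmem R hR Γ ?_) z hz) (by linarith)⟩
    exact hΓ (linkedTo_subset_linkedToSome h0 hi h0' hi' hv)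

theorem NominalSystem.exists_radius_controllable
    (S : NominalSystem n m qA qB qAd qBd η κ) (h : Fin η → ℝ) (h' : Fin κ → ℝ)
    (C : Set (Param qA qB qAd qBd)) :
    ∃ R₀ : ℝ, 0 < R₀ ∧ ∀ R, R₀ ≤ R → ∀ δ, 0 < δ →
      S.LowerBound {v | v ∈ linkedTo h h' ∧ ‖v.s‖ ≤ R} C δ → S.Controllable h h' C := by
  by_cases H : S.Controllable h h' C
  · exact ⟨1, one_pos, fun _ _ _ _ _ => H⟩
  · obtain ⟨v, hv, z, hz, hle⟩ := S.exists_detHat_nonpos H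
    obtain ⟨R₀, hR₀, hmem⟩ := exists_mem_truncate v
    exact ⟨R₀, hR₀, fun R hR δ hδ hlow =>
      absurd (hlow v ⟨hv, (hmem R hR _ hv).2.1⟩ z hz) (by linarith)⟩

/-- Multiplying on the right by the block column `(I; 0)` extracts `A`, and a product has rank at
most that of its left factor. -/
theorem rank_fromCols_of_isUnit {A : Matrix (Fin n) (Fin n) ℂ} (hA : IsUnit A)
    (B : Matrix (Fin n) (Fin m) ℂ) : (Matrix.fromCols A B).rank = n := by
  refine le_antisymm ((Matrix.rank_le_card_height _).trans_eq (Fintype.card_fin n)) ?_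
  have h1 := Matrix.rank_mul_le_left (Matrix.fromCols A B)
    (Matrix.fromRows (1 : Matrix (Fin n) (Fin n) ℂ) (0 : Matrix (Fin m) (Fin n) ℂ))
  rwa [Matrix.fromCols_mul_fromRows, Matrix.mul_one, Matrix.mul_zero, add_zero,
    Matrix.rank_of_isUnit A hA, Fintype.card_fin] at h1

open scoped Matrix.Norms.Operator in
theorem NominalSystem.exists_radius_rank_eq (S : NominalSystem n m qA qB qAd qBd η κ)
    {C : Set (Param qA qB qAd qBd)} (hC : Bornology.IsBounded C) (r : ℝ) :
    ∃ R₀ : ℝ, ∀ (s : ℂ) (w : Fin η → ℂ) (w' : Fin κ → ℂ), (∀ j, ‖w j‖ ≤ r) →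
      R₀ < ‖s‖ → ∀ z ∈ C, (S.ZC s w w' z).rank = n := by
  -- `F` collects everything subtracted from `sI`; it does not involve `w'`, which enters only the
  -- right block.
  let F : (Fin η → ℂ) × Param qA qB qAd qBd → Matrix (Fin n) (Fin n) ℂ := fun p =>
    ∑ i, (Fin.cons 1 p.2.1 : Fin (qA + 1) → ℂ) i • S.A i
      + ∑ j, p.1 j • ∑ i, p.2.2.2.1 i • S.Ad j i
  have hF : Continuous F := by
    simp only [F, Fin.sum_univ_succ, Fin.cons_zero, Fin.cons_succ]
    fun_prop
  -- The radius is `max r 0` because `r` may be negative, which the hypothesis on `w` permits when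
  -- there are no internal delays.
  have hb : Bornology.IsBounded ((Metric.closedBall (0 : Fin η → ℂ) (max r 0)) ×ˢ C) :=
    Metric.isBounded_closedBall.prod hC
  obtain ⟨K, hK⟩ := hb.isCompact_closure.exists_bound_of_continuousOn hF.continuousOn
  -- The factor `‖1‖` is kept because the identity has norm `0` when `n = 0`.
  refine ⟨K * ‖(1 : Matrix (Fin n) (Fin n) ℂ)‖, fun s w w' hw hs z hz => ?_⟩
  have hp : (w, z) ∈ closure ((Metric.closedBall (0 : Fin η → ℂ) (max r 0)) ×ˢ C) := by
    refine subset_closure ⟨?_, hz⟩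
    rw [mem_closedBall_zero_iff]
    exact (pi_norm_le_iff_of_nonneg (le_max_right _ _)).2 fun j => (hw j).trans (le_max_left _ _)
  have hres : s ∈ resolventSet ℂ (F (w, z)) :=
    spectrum.mem_resolventSet_of_norm_lt_mul
      ((mul_le_mul_of_nonneg_right (hK _ hp) (norm_nonneg _)).trans_lt hs)
  rw [spectrum.mem_resolventSet_iff, Algebra.algebraMap_eq_smul_one] at hres
  refine rank_fromCols_of_isUnit ?_ _
  rwa [sub_sub]

end System

/-! ### Smoothness of the determinants in real coordinates. -/

section Smoothness

variable {E : Type*} [NormedAddCommGroup E] [NormedSpace ℝ E]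

theorem contDiff_ofReal {f : E → ℝ} (hf : ContDiff ℝ 1 f) : ContDiff ℝ 1 fun x => (f x : ℂ) :=
  Complex.ofRealCLM.contDiff.comp hf

theorem contDiff_complex_mk {f g : E → ℝ} (hf : ContDiff ℝ 1 f) (hg : ContDiff ℝ 1 g) :
    ContDiff ℝ 1 fun x => (⟨f x, g x⟩ : ℂ) := by
  simp only [Complex.mk_eq_add_mul_I]
  exact (contDiff_ofReal hf).add ((contDiff_ofReal hg).mul contDiff_const)

theorem contDiff_det {k : ℕ} {M : E → Matrix (Fin k) (Fin k) ℂ}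
    (hM : ∀ i j, ContDiff ℝ 1 fun x => M x i j) : ContDiff ℝ 1 fun x => (M x).det := by
  simp only [Matrix.det_apply']
  exact ContDiff.sum fun σ _ => contDiff_const.mul (contDiff_prod fun i _ => hM _ _)

variable {n m qA qB qAd qBd η κ : ℕ}

theorem contDiff_cons_apply {q : ℕ} {z : E → Fin q → ℂ} (hz : ∀ i, ContDiff ℝ 1 fun x => z x i)
    (i : Fin (q + 1)) : ContDiff ℝ 1 fun x => (Fin.cons 1 (z x) : Fin (q + 1) → ℂ) i := by
  cases i using Fin.cases with
  | zero => simpa using contDiff_const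
  | succ i => simpa using hz i

/-- The determinant is a polynomial in the entries of `Z` and their conjugates. Conjugation is
smooth only over `ℝ`, which is why differentiability is real throughout. -/
theorem NominalSystem.contDiff_detZ (S : NominalSystem n m qA qB qAd qBd η κ)
    {s : E → ℂ} {w : E → Fin η → ℂ} {w' : E → Fin κ → ℂ} {z : E → Param qA qB qAd qBd}
    (hs : ContDiff ℝ 1 s) (hw : ∀ j, ContDiff ℝ 1 fun x => w x j)
    (hw' : ∀ j, ContDiff ℝ 1 fun x => w' x j)
    (hA : ∀ i, ContDiff ℝ 1 fun x => (z x).1 i) (hB : ∀ i, ContDiff ℝ 1 fun x => (z x).2.1 i)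
    (hAd : ∀ i, ContDiff ℝ 1 fun x => (z x).2.2.1 i)
    (hBd : ∀ i, ContDiff ℝ 1 fun x => (z x).2.2.2 i) :
    ContDiff ℝ 1 fun x => S.detZ (s x) (w x) (w' x) (z x) := by
  have hZ : ∀ i c, ContDiff ℝ 1 fun x => S.ZC (s x) (w x) (w' x) (z x) i c := by
    rintro i (j | j)
    · simp only [NominalSystem.ZC, Matrix.fromCols_apply_inl, Matrix.sub_apply, Matrix.smul_apply,
        Matrix.sum_apply, smul_eq_mul]
      exact ((hs.mul contDiff_const).sub (ContDiff.sum fun k _ =>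
        (contDiff_cons_apply hA k).mul contDiff_const)).sub (ContDiff.sum fun k _ =>
        (hw k).mul (ContDiff.sum fun l _ => (hAd l).mul contDiff_const))
    · simp only [NominalSystem.ZC, Matrix.fromCols_apply_inr, Matrix.add_apply, Matrix.smul_apply,
        Matrix.sum_apply, smul_eq_mul]
      exact (ContDiff.sum fun k _ =>
        (contDiff_cons_apply hB k).mul contDiff_const).add (ContDiff.sum fun k _ =>
        (hw' k).mul (ContDiff.sum fun l _ => (hBd l).mul contDiff_const))
  refine Complex.reCLM.contDiff.comp (contDiff_det fun i j => ?_)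
  simp only [Matrix.mul_apply, Matrix.conjTranspose_apply]
  exact ContDiff.sum fun c _ => (hZ i c).mul (Complex.conjCLE.contDiff.comp (hZ j c))

theorem contDiff_coord {ι : Type} [Fintype ι] (i : ι) : ContDiff ℝ 1 fun x : ι → ℝ => x i :=
  contDiff_apply ℝ ℝ i

theorem contDiff_polar {f g : E → ℝ} (hf : ContDiff ℝ 1 f) (hg : ContDiff ℝ 1 g) :
    ContDiff ℝ 1 fun x => polar (f x) (g x) :=
  (contDiff_ofReal hf).mul ((contDiff_ofReal hg.cos).add
    ((contDiff_ofReal hg.sin).mul contDiff_const))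

theorem NominalSystem.contDiff_detExt (S : NominalSystem n m qA qB qAd qBd η κ) :
    ContDiff ℝ 1 S.detExt :=
  S.contDiff_detZ
    ((contDiff_ofReal (contDiff_coord _)).add
      ((contDiff_ofReal (contDiff_coord _)).mul contDiff_const))
    (fun _ => contDiff_polar (contDiff_coord _) (contDiff_coord _))
    (fun _ => contDiff_polar (contDiff_coord _) (contDiff_coord _))
    (fun _ => contDiff_complex_mk (contDiff_coord _) (contDiff_coord _))
    (fun _ => contDiff_complex_mk (contDiff_coord _) (contDiff_coord _))
    (fun _ => contDiff_complex_mk (contDiff_coord _) (contDiff_coord _))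
    (fun _ => contDiff_complex_mk (contDiff_coord _) (contDiff_coord _))

theorem NominalSystem.contDiff_detDelay (S : NominalSystem n m qA qB qAd qBd η κ)
    (h : Fin η → ℝ) (h' : Fin κ → ℝ) : ContDiff ℝ 1 (S.detDelay h h') := by
  have hs : ContDiff ℝ 1 (argOf : (Coord qA qB qAd qBd → ℝ) → ℂ) :=
    contDiff_complex_mk (contDiff_coord _) (contDiff_coord _)
  exact S.contDiff_detZ hs
    (fun _ => (contDiff_const.mul hs).neg.cexp)
    (fun _ => (contDiff_const.mul hs).neg.cexp)
    (fun _ => contDiff_complex_mk (contDiff_coord _) (contDiff_coord _))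
    (fun _ => contDiff_complex_mk (contDiff_coord _) (contDiff_coord _))
    (fun _ => contDiff_complex_mk (contDiff_coord _) (contDiff_coord _))
    (fun _ => contDiff_complex_mk (contDiff_coord _) (contDiff_coord _))

end Smoothness

/-! ### Boundedness of the test regions, and lower bounds in coordinates. -/

section Regions

variable {n m qA qB qAd qBd η κ : ℕ}

instance : Nonempty (Coord qA qB qAd qBd) := ⟨Coord.sigma⟩

/-- The real coordinates of a Laplace argument and a parameter tuple. -/
def coordsOf (s : ℂ) (z : Param qA qB qAd qBd) : Coord qA qB qAd qBd → ℝ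
  | Coord.sigma => s.re
  | Coord.omega => s.im
  | Coord.reA i => (z.1 i).re
  | Coord.imA i => (z.1 i).im
  | Coord.reB i => (z.2.1 i).re
  | Coord.imB i => (z.2.1 i).im
  | Coord.reAd i => (z.2.2.1 i).re
  | Coord.imAd i => (z.2.2.1 i).im
  | Coord.reBd i => (z.2.2.2 i).re
  | Coord.imBd i => (z.2.2.2 i).im

/-- The real coordinates of a value of the extended variables and a parameter tuple. -/
def extCoordsOf (v : SigmaHat η κ) (z : Param qA qB qAd qBd) :
    Coord qA qB qAd qBd ⊕ DelayCoord η κ → ℝ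
  | Sum.inl c => coordsOf ⟨v.σ, v.ω⟩ z c
  | Sum.inr (DelayCoord.rho j) => v.ρ j
  | Sum.inr (DelayCoord.phi j) => v.φ j
  | Sum.inr (DelayCoord.rho' j) => v.ρ' j
  | Sum.inr (DelayCoord.phi' j) => v.φ' j

theorem exists_abs_coord_le {C : Set (Param qA qB qAd qBd)} (hC : Bornology.IsBounded C) (R : ℝ) :
    ∃ K, ∀ x ∈ regionDelay C R, ∀ c, |x c| ≤ K := by
  obtain ⟨K, hK⟩ := hC.exists_norm_le
  have hre : ∀ {q : ℕ} (y : Fin q → ℂ) (i : Fin q), |(y i).re| ≤ ‖y‖ := fun y i =>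
    (Complex.abs_re_le_norm _).trans (norm_le_pi_norm y i)
  have him : ∀ {q : ℕ} (y : Fin q → ℂ) (i : Fin q), |(y i).im| ≤ ‖y‖ := fun y i =>
    (Complex.abs_im_le_norm _).trans (norm_le_pi_norm y i)
  refine ⟨max R K, fun x ⟨hs, hz⟩ c => ?_⟩
  have hz := hK _ hz
  have h1 := (norm_fst_le (paramOf x)).trans hz
  have h2 := (norm_snd_le (paramOf x)).trans hz
  have h3 := (norm_fst_le (paramOf x).2).trans h2
  have h4 := (norm_snd_le (paramOf x).2).trans h2
  have h5 := (norm_fst_le (paramOf x).2.2).trans h4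
  have h6 := (norm_snd_le (paramOf x).2.2).trans h4
  cases c with
  | sigma => exact ((Complex.abs_re_le_norm (argOf x)).trans hs).trans (le_max_left _ _)
  | omega => exact ((Complex.abs_im_le_norm (argOf x)).trans hs).trans (le_max_left _ _)
  | reA i => exact ((hre (paramOf x).1 i).trans h1).trans (le_max_right _ _)
  | imA i => exact ((him (paramOf x).1 i).trans h1).trans (le_max_right _ _)
  | reB i => exact ((hre (paramOf x).2.1 i).trans h3).trans (le_max_right _ _)
  | imB i => exact ((him (paramOf x).2.1 i).trans h3).trans (le_max_right _ _)
  | reAd i => exact ((hre (paramOf x).2.2.1 i).trans h5).trans (le_max_right _ _)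
  | imAd i => exact ((him (paramOf x).2.2.1 i).trans h5).trans (le_max_right _ _)
  | reBd i => exact ((hre (paramOf x).2.2.2 i).trans h6).trans (le_max_right _ _)
  | imBd i => exact ((him (paramOf x).2.2.2 i).trans h6).trans (le_max_right _ _)

theorem isBounded_of_abs_le {ι : Type} [Fintype ι] {T : Set (ι → ℝ)} {K : ℝ}
    (h : ∀ x ∈ T, ∀ i, |x i| ≤ K) : Bornology.IsBounded T :=
  isBounded_iff_forall_norm_le.2 ⟨max K 0, fun x hx =>
    (pi_norm_le_iff_of_nonneg (le_max_right _ _)).2 fun i => (h x hx i).trans (le_max_left _ _)⟩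

theorem isBounded_regionDelay {C : Set (Param qA qB qAd qBd)} (hC : Bornology.IsBounded C)
    (R : ℝ) : Bornology.IsBounded (regionDelay C R) :=
  let ⟨_, hK⟩ := exists_abs_coord_le hC R
  isBounded_of_abs_le hK

theorem SigmaHat.s_extOf (x : Coord qA qB qAd qBd ⊕ DelayCoord η κ → ℝ) :
    (extOf x).s = argOf fun c => x (Sum.inl c) :=
  (Complex.mk_eq_add_mul_I _ _).symm

/-- Truncation bounds `s` and the moduli from above only; `delayFree` supplies the positivity of the
moduli and the bound `2π` on the angles. -/
theorem isBounded_regionExt {Γ : Set (SigmaHat η κ)} (hΓ : Γ ⊆ delayFree η κ)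
    {C : Set (Param qA qB qAd qBd)} (hC : Bornology.IsBounded C) (R : ℝ) :
    Bornology.IsBounded (regionExt Γ C R) := by
  obtain ⟨K, hK⟩ := exists_abs_coord_le hC R
  refine isBounded_of_abs_le (K := max K (max R (2 * Real.pi))) ?_
  rintro x ⟨⟨hxΓ, hs, hρ, hρ'⟩, hz⟩ (c | c)
  · rw [SigmaHat.s_extOf] at hs
    exact (hK (fun c => x (Sum.inl c)) ⟨hs, hz⟩ c).trans (le_max_left _ _)
  · refine le_trans ?_ (le_max_right _ _)
    obtain ⟨h1, h2, h3, h4⟩ := hΓ hxΓ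
    cases c with
    | rho j => exact (abs_of_pos (h1 j)).trans_le ((hρ j).trans (le_max_left _ _))
    | phi j => exact (abs_of_nonneg (h2 j).1).trans_le ((h2 j).2.le.trans (le_max_right _ _))
    | rho' j => exact (abs_of_pos (h3 j)).trans_le ((hρ' j).trans (le_max_left _ _))
    | phi' j => exact (abs_of_nonneg (h4 j).1).trans_le ((h4 j).2.le.trans (le_max_right _ _))

theorem NominalSystem.lowerBound_truncate_iff (S : NominalSystem n m qA qB qAd qBd η κ)
    (Γ : Set (SigmaHat η κ)) (C : Set (Param qA qB qAd qBd)) (R δ : ℝ) :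
    S.LowerBound (truncate Γ R) C δ ↔ ∀ x ∈ regionExt Γ C R, δ ≤ S.detExt x :=
  ⟨fun h _ hx => h _ hx.1 _ hx.2, fun h v hv z hz => h (extCoordsOf v z) ⟨hv, hz⟩⟩

/-- On the linked set the determinant depends on `s` and `z` alone, and every `s` is attained. The
test can thus drop the moduli and angles, and with them the jumps of the reduction modulo `2π`. -/
theorem NominalSystem.lowerBound_linkedTo_iff (S : NominalSystem n m qA qB qAd qBd η κ)
    (h : Fin η → ℝ) (h' : Fin κ → ℝ) (C : Set (Param qA qB qAd qBd)) (R δ : ℝ) :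
    S.LowerBound {v | v ∈ linkedTo h h' ∧ ‖v.s‖ ≤ R} C δ ↔
      ∀ x ∈ regionDelay C R, δ ≤ S.detDelay h h' x := by
  constructor
  · rintro H x ⟨hs, hz⟩
    obtain ⟨v, hv, hvs⟩ := exists_mem_linkedTo h h' (argOf x)
    have := H v ⟨hv, hvs ▸ hs⟩ _ hz
    rwa [S.detHat_of_mem_linkedTo hv, hvs] at this
  · rintro H v ⟨hv, hs⟩ z hz
    rw [S.detHat_of_mem_linkedTo hv]
    exact H (coordsOf v.s z) ⟨hs, hz⟩

end Regions

end DelayControl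

theorem theorem5p2 {n m qA qB qAd qBd η κ : ℕ}
    (S : DelayControl.NominalSystem n m qA qB qAd qBd η κ)
    (CA : Set (Fin qA → ℂ)) (CB : Set (Fin qB → ℂ))
    (CAd : Set (Fin qAd → ℂ)) (CBd : Set (Fin qBd → ℂ))
    (C : Set (DelayControl.Param qA qB qAd qBd)) (hC : C = CA ×ˢ CB ×ˢ CAd ×ˢ CBd)
    (hbdd : Bornology.IsBounded C) :
    -- (i) independence of the delays; the determinant may be tested on all delay-free extended
    -- variables, or only on those that are linked to `s` by some set of delays
    (∀ Γ : Set (DelayControl.SigmaHat η κ),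
      (Γ = DelayControl.delayFree η κ ∨ Γ = DelayControl.linkedToSome η κ) →
      ∀ δ : ℝ, 0 < δ → S.LowerBound Γ C δ → S.ControllableIndep C) ∧
    -- (ii) given delays
    (∀ (h : Fin η → ℝ) (h' : Fin κ → ℝ), (∀ j, 0 < h j) → Function.Injective h →
      (∀ j, 0 < h' j) → Function.Injective h' →
      ∀ δ : ℝ, 0 < δ → S.LowerBound (DelayControl.linkedTo h h') C δ → S.Controllable h h' C) ∧
    -- (iii) finite covers for (i)
    (∀ Γ : Set (DelayControl.SigmaHat η κ),
      (Γ = DelayControl.delayFree η κ ∨ Γ = DelayControl.linkedToSome η κ) →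
      (∀ R : ℝ, 0 < R →
        ((∃ δ : ℝ, 0 < δ ∧
            DelayControl.FiniteCoverTest S.detExt (DelayControl.regionExt Γ C R) δ) ↔
          ∃ δ : ℝ, 0 < δ ∧ S.LowerBound (DelayControl.truncate Γ R) C δ)) ∧
      ∃ R₀ : ℝ, 0 < R₀ ∧ ∀ R : ℝ, R₀ ≤ R → ∀ δ : ℝ, 0 < δ →
        DelayControl.FiniteCoverTest S.detExt (DelayControl.regionExt Γ C R) δ →
        S.ControllableIndep C) ∧
    -- (iii) finite covers for (ii)
    (∀ (h : Fin η → ℝ) (h' : Fin κ → ℝ), (∀ j, 0 < h j) → Function.Injective h →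
      (∀ j, 0 < h' j) → Function.Injective h' →
      (∀ R : ℝ, 0 < R →
        ((∃ δ : ℝ, 0 < δ ∧
            DelayControl.FiniteCoverTest (S.detDelay h h') (DelayControl.regionDelay C R) δ) ↔
          ∃ δ : ℝ, 0 < δ ∧
            S.LowerBound {v | v ∈ DelayControl.linkedTo h h' ∧ ‖v.s‖ ≤ R} C δ)) ∧
      ∃ R₀ : ℝ, 0 < R₀ ∧ ∀ R : ℝ, R₀ ≤ R → ∀ δ : ℝ, 0 < δ →
        DelayControl.FiniteCoverTest (S.detDelay h h') (DelayControl.regionDelay C R) δ →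
        S.Controllable h h' C) ∧
    -- (iii) outside a disc there is nothing to test as long as the moduli for the internal
    -- delays stay bounded
    (∀ r : ℝ, ∃ R₀ : ℝ, ∀ (s : ℂ) (w : Fin η → ℂ) (w' : Fin κ → ℂ), (∀ j, ‖w j‖ ≤ r) →
      R₀ < ‖s‖ → ∀ z ∈ C, (S.ZC s w w' z).rank = n) := by
  -- Both choices of `Γ` lie between these two sets: the lower inclusion yields controllability, the
  -- upper one boundedness of the region.
  have hsub : ∀ Γ : Set (DelayControl.SigmaHat η κ),
      (Γ = DelayControl.delayFree η κ ∨ Γ = DelayControl.linkedToSome η κ) →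
      DelayControl.linkedToSome η κ ⊆ Γ ∧ Γ ⊆ DelayControl.delayFree η κ := by
    rintro Γ (rfl | rfl)
    · exact ⟨DelayControl.linkedToSome_subset_delayFree, subset_rfl⟩
    · exact ⟨subset_rfl, DelayControl.linkedToSome_subset_delayFree⟩
  refine ⟨fun Γ hΓ δ hδ H => S.controllableIndep_of_lowerBound (hsub Γ hΓ).1 hδ H,
    fun h h' _ _ _ _ δ hδ H => S.controllable_of_lowerBound hδ H,
    fun Γ hΓ => ⟨fun R _ => ?_, ?_⟩, fun h h' _ _ _ _ => ⟨fun R _ => ?_, ?_⟩,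
    S.exists_radius_rank_eq hbdd⟩
  · simp only [S.lowerBound_truncate_iff]
    exact DelayControl.exists_finiteCoverTest_iff S.contDiff_detExt
      (DelayControl.isBounded_regionExt (hsub Γ hΓ).2 hbdd R)
  · obtain ⟨R₀, hR₀, H⟩ := S.exists_radius_controllableIndep (hsub Γ hΓ).1 C
    exact ⟨R₀, hR₀, fun R hR δ hδ hT => H R hR δ hδ ((S.lowerBound_truncate_iff Γ C R δ).2
      fun x hx => hT.le_apply (S.contDiff_detExt.differentiable one_ne_zero) hx)⟩
  · simp only [S.lowerBound_linkedTo_iff]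
    exact DelayControl.exists_finiteCoverTest_iff (S.contDiff_detDelay h h')
      (DelayControl.isBounded_regionDelay hbdd R)
  · obtain ⟨R₀, hR₀, H⟩ := S.exists_radius_controllable h h' C
    exact ⟨R₀, hR₀, fun R hR δ hδ hT => H R hR δ hδ ((S.lowerBound_linkedTo_iff h h' C R δ).2
      fun x hx => hT.le_apply ((S.contDiff_detDelay h h').differentiable one_ne_zero) hx)⟩
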